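/- Let $(Y,d_Y)$ be a compact metric space and $g\colon Y\to Y$ a continuous surjection satisfying Wieler's axioms: there are constants $\beta>0$, $K\in\mathbb{N}^+$ and $0<\gamma<1$ such that (1) if $d_Y(x,y)\le\beta$, then $d_Y(g^K(x),g^K(y))\le\gamma^K d_Y(g^{2K}(x),g^{2K}(y))$; (2) $g^K(B(g^K(x),\epsilon))\subseteq g^{2K}(B(x,\gamma\epsilon))$ for all $x\in Y$ and $0<\epsilon\le\beta$, where $B$ denotes open balls. Let $X=\{(x_n)_{n\ge 0}\in Y^{\mathbb{N}} : g(x_{n+1})=x_n \text{ for all } n\}$ with the product topology, let $\varphi\colon X\to X$, $\varphi(x_0,x_1,\dots)=(g(x_0),g(x_1),\dots)=(g(x_0),x_0,x_1,\dots)$, and let $$d_X(\mathbf{x},\mathbf{y})=\sum_{i=0}^{K}\gamma^i d'_X(\varphi^i(\mathbf{x}),\varphi^i(\mathbf{y})),\qquad d'_X(\mathbf{x},\mathbf{y})=\sup_{n\ge 0}\gamma^n d_Y(x_n,y_n).$$ The system $(X,\varphi)$ is the associated Wieler solenoid, and for $0<\epsilon\le\beta/2$ its local unstable sets are $$X^u(\mathbf{x},\epsilon)=\{\mathbf{y}\in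 X : d_Y(x_n,y_n)<\epsilon \text{ for all } n,\ d_X(\mathbf{x},\mathbf{y})<\epsilon\}.$$ Let $\mathbf{P}\subseteq X$ be a finite set of periodic points of $\varphi$ with $\varphi(\mathbf{P})=\mathbf{P}$, and let $$X^u(\mathbf{P})=\{\mathbf{x}\in X : \lim_{n\to\infty}d_X(\varphi^{-n}(\mathbf{x}),\varphi^{-n}(\mathbf{p}))=0 \text{ for some } \mathbf{p}\in\mathbf{P}\},$$ equipped with the topology in which the sets $X^u(\mathbf{x},\delta)$, $0<\delta\le\beta/2$, form a neighbourhood base at $\mathbf{x}$. Put $\pi_0(\mathbf{x})=x_0$, fix $0<\epsilon_Y\le\beta/2$, and for $\mathbf{x},\mathbf{y}\in X^u(\mathbf{P})$ write $\mathbf{x}\sim_0\mathbf{y}$ if $x_0=y_0$ and there are $0<\delta<\epsilon_Y$ and an open set $U\subseteq X^u(\mathbf{y},\epsilon_Y)$ of $X^u(\mathbf{P})$ with $\pi_0(X^u(\mathbf{x},\delta))=\pi_0(U)$. This is an equivalence relation. Give $X^u(\mathbf{P})/{\sim_0}$ the quotient topology, and let $\tilde g\colon X^u(\mathbf{P})/{\sim_0}\to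 X^u(\mathbf{P})/{\sim_0}$ be the well-defined map $\tilde g([\mathbf{x}])=[\varphi(\mathbf{x})]$. Suppose that $(X,\varphi)$ is mixing, that is, for all non-empty open sets $A,B\subseteq X$ there is $N$ with $\varphi^n(A)\cap B\ne\emptyset$ for all $n\ge N$. Then for every non-empty open set $U\subseteq X^u(\mathbf{P})/{\sim_0}$ there exists $N\in\mathbb{N}$ such that $\tilde g^N(U)=X^u(\mathbf{P})/{\sim_0}$. -/

import Mathlib

open Filter Topology

/-- A pre-solenoid `(Y, d, g)` satisfying Wieler's axioms, together with its constants. -/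
structure WielerPresolenoid (Y : Type*) [MetricSpace Y] where
  /-- the self-map of `Y` -/
  g : Y → Y
  /-- the scale on which the axioms apply -/
  β : ℝ
  /-- the contraction factor -/
  γ : ℝ
  /-- the iterate used in the axioms -/
  K : ℕ
  continuous_g : Continuous g
  surjective_g : Function.Surjective g
  β_pos : 0 < β
  K_pos : 0 < K
  γ_pos : 0 < γ
  γ_lt_one : γ < 1
  axiom1 : ∀ x y : Y, dist x y ≤ β →
    dist (g^[K] x) (g^[K] y) ≤ γ ^ K * dist (g^[2 * K] x) (g^[2 * K] y)
  axiom2 : ∀ (x : Y) (ε : ℝ), 0 < ε → ε ≤ β →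
    g^[K] '' Metric.ball (g^[K] x) ε ⊆ g^[2 * K] '' Metric.ball x (γ * ε)

/-- A self-map `f` of a topological space is (topologically) mixing. -/
def IsMixing {Z : Type*} [TopologicalSpace Z] (f : Z → Z) : Prop :=
  ∀ U V : Set Z, IsOpen U → IsOpen V → U.Nonempty → V.Nonempty →
    ∃ N : ℕ, ∀ n : ℕ, N ≤ n → (f^[n] '' U ∩ V).Nonempty

namespace WielerPresolenoid

variable {Y : Type*} [MetricSpace Y] (W : WielerPresolenoid Y)

/-- The inverse limit `X` of `Y ← Y ← Y ← ⋯` along `g`, with the product topology. -/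
abbrev Solenoid : Type _ := {x : ℕ → Y // ∀ i, W.g (x (i + 1)) = x i}

/-- `φ (x₀, x₁, …) = (g x₀, g x₁, …)`, with inverse `(x₀, x₁, …) ↦ (x₁, x₂, …)`. -/
def φ : W.Solenoid ≃ W.Solenoid where
  toFun x := ⟨fun n => W.g (x.1 n), fun i => congrArg W.g (x.2 i)⟩
  invFun x := ⟨fun n => x.1 (n + 1), fun i => x.2 (i + 1)⟩
  left_inv x := Subtype.ext (funext fun n => x.2 n)
  right_inv x := Subtype.ext (funext fun n => x.2 n)

/-- `d'(x, y) = sup_n γⁿ d(xₙ, yₙ)`. -/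
noncomputable def predistX (x y : W.Solenoid) : ℝ := ⨆ n : ℕ, W.γ ^ n * dist (x.1 n) (y.1 n)

/-- The metric `d_X(x, y) = ∑_{i=0}^{K} γⁱ d'(φⁱ x, φⁱ y)` of the solenoid. -/
noncomputable def distX (x y : W.Solenoid) : ℝ :=
  ∑ i ∈ Finset.range (W.K + 1), W.γ ^ i * W.predistX (W.φ^[i] x) (W.φ^[i] y)

/-- `x ∼ᵤ y`: the backward orbits of `x` and `y` are asymptotic. -/
def UnstableEquiv (x y : W.Solenoid) : Prop :=
  Tendsto (fun n : ℕ => W.distX (W.φ.symm^[n] x) (W.φ.symm^[n] y)) atTop (𝓝 0)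

/-- The local unstable set `X^u(x, ε)` (for `0 < ε ≤ β / 2`) of the Smale space `(X, d_X, φ)`. -/
def localUnstable (x : W.Solenoid) (ε : ℝ) : Set W.Solenoid :=
  {y | (∀ n, dist (x.1 n) (y.1 n) < ε) ∧ W.distX x y < ε}

lemma localUnstable_mono (x : W.Solenoid) {a b : ℝ} (h : a ≤ b) :
    W.localUnstable x a ⊆ W.localUnstable x b :=
  fun _ hy => ⟨fun n => (hy.1 n).trans_le h, hy.2.trans_le h⟩

/-- `X^u(P)`, the set of points of `X` that are unstably equivalent to a point of `P`. -/
def GlobalUnstable (P : Set W.Solenoid) : Type _ :=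
  {x : W.Solenoid // ∃ p ∈ P, W.UnstableEquiv x p}

variable {W} in
/-- The local unstable set `X^u(x, ε)` of a point of `X^u(P)`, as a subset of `X^u(P)`. -/
def GlobalUnstable.ball {P : Set W.Solenoid} (x : W.GlobalUnstable P) (ε : ℝ) :
    Set (W.GlobalUnstable P) := {y | y.1 ∈ W.localUnstable x.1 ε}

/-- The (locally compact Hausdorff) unstable topology of `X^u(P)`, which is finer than the
topology inherited from `X`: the local unstable sets `X^u(x, δ)` form a neighbourhood base
at `x`. -/
instance (P : Set W.Solenoid) : TopologicalSpace (W.GlobalUnstable P) where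
  IsOpen U := ∀ x ∈ U, ∃ δ > 0, x.ball δ ⊆ U
  isOpen_univ := fun _ _ => ⟨1, one_pos, Set.subset_univ _⟩
  isOpen_inter := by
    rintro s t hs ht x ⟨hxs, hxt⟩
    obtain ⟨a, ha, ha'⟩ := hs x hxs
    obtain ⟨b, hb, hb'⟩ := ht x hxt
    exact ⟨min a b, lt_min ha hb, fun y hy =>
      ⟨ha' (W.localUnstable_mono _ (min_le_left _ _) hy),
        hb' (W.localUnstable_mono _ (min_le_right _ _) hy)⟩⟩
  isOpen_sUnion := by
    rintro S hS x ⟨s, hs, hx⟩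
    obtain ⟨δ, hδ, h⟩ := hS s hs x hx
    exact ⟨δ, hδ, h.trans (Set.subset_sUnion_of_mem hs)⟩

variable {W} in
lemma GlobalUnstable.isOpen_iff {P : Set W.Solenoid} {U : Set (W.GlobalUnstable P)} :
    IsOpen U ↔ ∀ x ∈ U, ∃ δ > 0, x.ball δ ⊆ U := Iff.rfl

variable {W} in
/-- The projection `π₀ (x₀, x₁, …) = x₀` on `X^u(P)`. -/
def GlobalUnstable.π₀ {P : Set W.Solenoid} (x : W.GlobalUnstable P) : Y := x.1.1 0

/-- The relation `x ∼₀ y` on `X^u(P)`, with respect to a scale `εY`. -/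
def SimZero (P : Set W.Solenoid) (εY : ℝ) (x y : W.GlobalUnstable P) : Prop :=
  x.π₀ = y.π₀ ∧ ∃ δ : ℝ, 0 < δ ∧ δ < εY ∧ ∃ U : Set (W.GlobalUnstable P),
    IsOpen U ∧ U ⊆ y.ball εY ∧ GlobalUnstable.π₀ '' x.ball δ = GlobalUnstable.π₀ '' U

/-! Helper facts: `∼₀` is an equivalence relation, and it is preserved by `φ`. -/

section Helpers

variable {W}

lemma iterate_val (x : W.Solenoid) (n j : ℕ) : W.g^[j] (x.1 (n + j)) = x.1 n := by
  induction j generalizing n with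
  | zero => rfl
  | succ j ih =>
    rw [Function.iterate_succ_apply, ← add_assoc, x.2 (n + j), ih]

lemma φ_iterate_val (x : W.Solenoid) (i n : ℕ) : (W.φ^[i] x).1 n = W.g^[i] (x.1 n) := by
  induction i generalizing x with
  | zero => rfl
  | succ i ih => rw [Function.iterate_succ_apply, ih, Function.iterate_succ_apply]; rfl

lemma dist_val_add_K {x y : W.Solenoid} (h : ∀ n, dist (x.1 n) (y.1 n) ≤ W.β) (n : ℕ) :
    dist (x.1 (n + W.K)) (y.1 (n + W.K)) ≤ W.γ ^ W.K * dist (x.1 n) (y.1 n) := by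
  have := W.axiom1 _ _ (h (n + 2 * W.K))
  rw [iterate_val x n, iterate_val y n] at this
  rwa [show n + 2 * W.K = (n + W.K) + W.K by ring, iterate_val, iterate_val] at this

lemma dist_val_add_K_le {x y : W.Solenoid} (h : ∀ n, dist (x.1 n) (y.1 n) ≤ W.β) (n : ℕ) :
    dist (x.1 (n + W.K)) (y.1 (n + W.K)) ≤ dist (x.1 n) (y.1 n) :=
  (dist_val_add_K h n).trans
    (mul_le_of_le_one_left dist_nonneg (pow_le_one₀ W.γ_pos.le W.γ_lt_one.le))

lemma dist_val_mul_K_le {x y : W.Solenoid} (h : ∀ n, dist (x.1 n) (y.1 n) ≤ W.β) (m : ℕ) :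
    dist (x.1 (m * W.K)) (y.1 (m * W.K)) ≤ dist (x.1 0) (y.1 0) := by
  induction m with
  | zero => simp
  | succ m ih => rw [Nat.succ_mul]; exact (dist_val_add_K_le h _).trans ih

lemma exists_mul_K (n : ℕ) : ∃ m j : ℕ, j ≤ W.K ∧ m * W.K = n + j := by
  have h := Nat.div_add_mod n W.K
  have h' := Nat.mod_lt n W.K_pos
  refine ⟨n / W.K + 1, W.K - n % W.K, Nat.sub_le _ _, ?_⟩
  have : (n / W.K + 1) * W.K = W.K * (n / W.K) + W.K := by ring
  omega

lemma eq_of_val_zero_eq {x y : W.Solenoid} (h : ∀ n, dist (x.1 n) (y.1 n) ≤ W.β)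
    (h0 : x.1 0 = y.1 0) : x = y := by
  refine Subtype.ext (funext fun n => ?_)
  obtain ⟨m, j, -, hm⟩ := exists_mul_K (W := W) n
  have := dist_val_mul_K_le h m
  rw [h0, dist_self] at this
  have := dist_le_zero.1 this
  rw [hm] at this
  rw [← iterate_val x n j, ← iterate_val y n j, this]

lemma predistX_le {x y : W.Solenoid} {c : ℝ} (h : ∀ n, dist (x.1 n) (y.1 n) ≤ c) :
    W.predistX x y ≤ c :=
  ciSup_le fun n => (mul_le_of_le_one_left dist_nonneg
    (pow_le_one₀ W.γ_pos.le W.γ_lt_one.le)).trans (h n)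

/-- One half of `∼₀`, free of the scale: points near `x` can be matched, without changing
the coordinate with index zero, by points near `y`. -/
def Matches {P : Set W.Solenoid} (x y : W.GlobalUnstable P) : Prop :=
  ∀ η > 0, ∃ δ > 0, ∀ z : W.GlobalUnstable P, (∀ n, dist (x.1.1 n) (z.1.1 n) < δ) →
    ∃ w : W.GlobalUnstable P, (∀ n, dist (y.1.1 n) (w.1.1 n) < η) ∧ w.π₀ = z.π₀

lemma Matches.trans {P : Set W.Solenoid} {x y z : W.GlobalUnstable P} (h : Matches x y)
    (h' : Matches y z) : Matches x z := by
  intro η hη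
  obtain ⟨a, ha, h1⟩ := h' η hη
  obtain ⟨b, hb, h2⟩ := h a ha
  refine ⟨b, hb, fun u hu => ?_⟩
  obtain ⟨v, hv, hv'⟩ := h2 u hu
  obtain ⟨w, hw, hw'⟩ := h1 v hv
  exact ⟨w, hw, hw'.trans hv'⟩

variable [CompactSpace Y]

variable (W) in
lemma exists_unif (M : ℕ) {η : ℝ} (hη : 0 < η) : ∃ δ > 0, ∀ j ≤ M, ∀ a b : Y,
    dist a b < δ → dist (W.g^[j] a) (W.g^[j] b) < η := by
  induction M with
  | zero => exact ⟨η, hη, fun j hj a b h => by simpa [Nat.le_zero.1 hj] using h⟩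
  | succ M ih =>
    obtain ⟨δ, hδ, h⟩ := ih
    obtain ⟨δ', hδ', h'⟩ := Metric.uniformContinuous_iff.1
      (CompactSpace.uniformContinuous_of_continuous (W.continuous_g.iterate (M + 1))) η hη
    refine ⟨min δ δ', lt_min hδ hδ', fun j hj a b hab => ?_⟩
    rcases Nat.le_succ_iff.1 hj with hj | rfl
    · exact h j hj a b (hab.trans_le (min_le_left _ _))
    · exact h' (hab.trans_le (min_le_right _ _))

variable (W) in
lemma exists_of_val_zero {η : ℝ} (hη : 0 < η) : ∃ δ > 0, ∀ x y : W.Solenoid,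
    (∀ n, dist (x.1 n) (y.1 n) ≤ W.β) → dist (x.1 0) (y.1 0) < δ →
    ∀ n, dist (x.1 n) (y.1 n) < η := by
  obtain ⟨δ, hδ, h⟩ := W.exists_unif W.K hη
  refine ⟨δ, hδ, fun x y hxy h0 n => ?_⟩
  obtain ⟨m, j, hj, hm⟩ := exists_mul_K (W := W) n
  have := (dist_val_mul_K_le hxy m).trans_lt h0
  rw [hm] at this
  rw [← iterate_val x n j, ← iterate_val y n j]
  exact h j hj _ _ this

lemma le_predistX (x y : W.Solenoid) (n : ℕ) :
    W.γ ^ n * dist (x.1 n) (y.1 n) ≤ W.predistX x y := by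
  refine le_ciSup (f := fun n : ℕ => W.γ ^ n * dist (x.1 n) (y.1 n)) ?_ n
  refine ⟨Metric.diam (Set.univ : Set Y), ?_⟩
  rintro _ ⟨k, rfl⟩
  exact (mul_le_of_le_one_left dist_nonneg (pow_le_one₀ W.γ_pos.le W.γ_lt_one.le)).trans
    (Metric.dist_le_diam_of_mem isCompact_univ.isBounded trivial trivial)

lemma predistX_triangle (x y z : W.Solenoid) :
    W.predistX x z ≤ W.predistX x y + W.predistX y z := by
  refine ciSup_le fun n => ?_
  have h1 := le_predistX x y n
  have h2 := le_predistX y z n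
  have h3 := mul_le_mul_of_nonneg_left (dist_triangle (x.1 n) (y.1 n) (z.1 n))
    (pow_nonneg W.γ_pos.le n)
  linarith

lemma distX_triangle (x y z : W.Solenoid) : W.distX x z ≤ W.distX x y + W.distX y z := by
  unfold distX
  rw [← Finset.sum_add_distrib]
  refine Finset.sum_le_sum fun i _ => ?_
  rw [← mul_add]
  exact mul_le_mul_of_nonneg_left (predistX_triangle _ _ _) (pow_nonneg W.γ_pos.le i)

variable (W) in
lemma exists_mem_localUnstable {η : ℝ} (hη : 0 < η) : ∃ δ > 0, ∀ x y : W.Solenoid,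
    (∀ n, dist (x.1 n) (y.1 n) < δ) → y ∈ W.localUnstable x η := by
  have hK : (0 : ℝ) < W.K + 2 := by positivity
  obtain ⟨δ, hδ, h⟩ := W.exists_unif W.K (div_pos hη hK)
  refine ⟨min δ η, lt_min hδ hη, fun x y hxy => ⟨fun n => (hxy n).trans_le (min_le_right _ _), ?_⟩⟩
  have key : W.distX x y ≤ ∑ i ∈ Finset.range (W.K + 1), η / (W.K + 2) := by
    refine Finset.sum_le_sum fun i hi => ?_
    have h1 : W.predistX (W.φ^[i] x) (W.φ^[i] y) ≤ η / (W.K + 2) := by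
      refine predistX_le fun n => ?_
      rw [φ_iterate_val, φ_iterate_val]
      exact (h i (Nat.lt_succ_iff.1 (Finset.mem_range.1 hi)) _ _
        ((hxy n).trans_le (min_le_left _ _))).le
    calc W.γ ^ i * W.predistX (W.φ^[i] x) (W.φ^[i] y) ≤ W.γ ^ i * (η / (W.K + 2)) :=
          mul_le_mul_of_nonneg_left h1 (pow_nonneg W.γ_pos.le i)
      _ ≤ η / (W.K + 2) := mul_le_of_le_one_left (div_pos hη hK).le
          (pow_le_one₀ W.γ_pos.le W.γ_lt_one.le)
  refine key.trans_lt ?_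
  rw [Finset.sum_const, Finset.card_range, nsmul_eq_mul, mul_div_assoc', div_lt_iff₀ hK]
  push_cast
  nlinarith

lemma exists_subset_localUnstable {x z : W.Solenoid} {ε : ℝ} (hε : ε ≤ W.β)
    (hz : z ∈ W.localUnstable x ε) : ∃ r > 0, ∀ w : W.Solenoid,
    (∀ n, dist (z.1 n) (w.1 n) < r) → w ∈ W.localUnstable x ε := by
  obtain ⟨c, hc, hcb⟩ : ∃ c < ε, ∀ n, dist (x.1 n) (z.1 n) ≤ c := by
    obtain ⟨k, -, hk⟩ := Finset.exists_max_image (Finset.range W.K)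
      (fun n => dist (x.1 n) (z.1 n)) ⟨0, Finset.mem_range.2 W.K_pos⟩
    refine ⟨_, hz.1 k, fun n => ?_⟩
    induction n using Nat.strong_induction_on with
    | _ n ih =>
      by_cases hn : n < W.K
      · exact hk n (Finset.mem_range.2 hn)
      · have := dist_val_add_K_le (fun n => (hz.1 n).le.trans hε) (n - W.K)
        rw [Nat.sub_add_cancel (not_lt.1 hn)] at this
        exact this.trans (ih _ (Nat.sub_lt (W.K_pos.trans_le (not_lt.1 hn)) W.K_pos))
  obtain ⟨δ, hδ, h⟩ := W.exists_mem_localUnstable (sub_pos.2 hz.2)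
  refine ⟨min δ (ε - c), lt_min hδ (sub_pos.2 hc), fun w hw => ⟨fun n => ?_, ?_⟩⟩
  · have := (hw n).trans_le (min_le_right _ _)
    have := dist_triangle (x.1 n) (z.1 n) (w.1 n)
    linarith [hcb n]
  · have := (h z w fun n => (hw n).trans_le (min_le_left _ _)).2
    linarith [distX_triangle x z w]

lemma GlobalUnstable.isOpen_ball {P : Set W.Solenoid} (x : W.GlobalUnstable P) {ε : ℝ}
    (hε : ε ≤ W.β) : IsOpen (x.ball ε) := by
  intro z hz
  obtain ⟨r, hr, h⟩ := exists_subset_localUnstable hε hz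
  exact ⟨r, hr, fun w hw => h w.1 hw.1⟩

lemma self_mem_localUnstable (x : W.Solenoid) {ε : ℝ} (hε : 0 < ε) :
    x ∈ W.localUnstable x ε := by
  obtain ⟨δ, hδ, h⟩ := W.exists_mem_localUnstable hε
  exact h x x fun n => by simpa using hδ

lemma simZero_iff {P : Set W.Solenoid} {εY : ℝ} (hε : εY ∈ Set.Ioc 0 (W.β / 2))
    (x y : W.GlobalUnstable P) :
    W.SimZero P εY x y ↔ x.π₀ = y.π₀ ∧ Matches x y ∧ Matches y x := by
  obtain ⟨hε0, hεβ⟩ := hε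
  have hβ := W.β_pos
  constructor
  · rintro ⟨h0, δ, hδ, hδε, U, hU, hUy, himg⟩
    refine ⟨h0, fun η hη => ?_, fun η hη => ?_⟩
    · obtain ⟨a, ha, h1⟩ := W.exists_mem_localUnstable hδ
      obtain ⟨b, hb, h2⟩ := W.exists_of_val_zero hη
      refine ⟨min a b, lt_min ha hb, fun z hz => ?_⟩
      have hzx : z ∈ x.ball δ := h1 _ _ fun n => (hz n).trans_le (min_le_left _ _)
      obtain ⟨w, hwU, hw⟩ := himg ▸ Set.mem_image_of_mem GlobalUnstable.π₀ hzx
      refine ⟨w, h2 _ _ (fun n => ?_) ?_, hw⟩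
      · linarith [(hUy hwU).1 n]
      · change dist y.π₀ w.π₀ < b
        rw [← h0, hw]
        exact (hz 0).trans_le (min_le_right _ _)
    · have hyU : y ∈ U := by
        have hx : x ∈ x.ball δ := self_mem_localUnstable x.1 hδ
        obtain ⟨u, huU, hu⟩ := himg ▸ Set.mem_image_of_mem GlobalUnstable.π₀ hx
        have : y = u := Subtype.ext (eq_of_val_zero_eq
          (fun n => by linarith [(hUy huU).1 n]) (h0.symm.trans hu.symm))
        rwa [this]
      obtain ⟨c, hc, hcU⟩ := GlobalUnstable.isOpen_iff.1 hU y hyU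
      obtain ⟨a, ha, h1⟩ := W.exists_mem_localUnstable hc
      obtain ⟨b, hb, h2⟩ := W.exists_of_val_zero hη
      refine ⟨min a b, lt_min ha hb, fun z hz => ?_⟩
      have hzU : z ∈ U := hcU (h1 _ _ fun n => (hz n).trans_le (min_le_left _ _))
      obtain ⟨w, hwx, hw⟩ := himg.symm ▸ Set.mem_image_of_mem GlobalUnstable.π₀ hzU
      refine ⟨w, h2 _ _ (fun n => ?_) ?_, hw⟩
      · linarith [hwx.1 n]
      · change dist x.π₀ w.π₀ < b
        rw [h0, hw]
        exact (hz 0).trans_le (min_le_right _ _)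
  · rintro ⟨h0, hxy, hyx⟩
    refine ⟨h0, ?_⟩
    obtain ⟨a, ha, h1⟩ := hyx (W.β / 2) (by linarith)
    obtain ⟨b, hb, h2⟩ := W.exists_mem_localUnstable hε0
    obtain ⟨d, hd, h3⟩ := hxy (min a b / 2) (by have := lt_min ha hb; linarith)
    have hab := lt_min ha hb
    set δ := min d (εY / 2) with hδ
    have hδ0 : 0 < δ := lt_min hd (by linarith)
    have hδε : δ < εY := (min_le_right _ _).trans_lt (by linarith)
    refine ⟨δ, hδ0, hδε, {u | (∃ c < min a b, ∀ n, dist (y.1.1 n) (u.1.1 n) ≤ c) ∧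
      ∃ z ∈ x.ball δ, z.π₀ = u.π₀}, ?_, ?_, ?_⟩
    · rw [GlobalUnstable.isOpen_iff]
      rintro u ⟨⟨c, hc, hcu⟩, z, hz, hzu⟩
      obtain ⟨r, hr, hr'⟩ := exists_subset_localUnstable (by linarith) hz
      obtain ⟨s, hs, hs'⟩ := W.exists_of_val_zero hr
      have hc' : 0 < (min a b - c) / 2 := by linarith
      refine ⟨min s ((min a b - c) / 2), lt_min hs hc', fun u' hu' => ?_⟩
      have hu1 : ∀ n, dist (y.1.1 n) (u'.1.1 n) ≤ (min a b + c) / 2 := fun n => by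
        have e1 := (hu'.1 n).trans_le (min_le_right _ _)
        linarith [hcu n, dist_triangle (y.1.1 n) (u.1.1 n) (u'.1.1 n)]
      refine ⟨⟨_, by linarith, hu1⟩, ?_⟩
      obtain ⟨z', hz', hzu'⟩ := h1 u' fun n => by
        linarith [hu1 n, min_le_left a b]
      refine ⟨z', hr' z'.1 (hs' z.1 z'.1 (fun n => ?_) ?_), hzu'⟩
      · have e1 := hz.1 n
        rw [dist_comm] at e1
        linarith [hz' n, dist_triangle (z.1.1 n) (x.1.1 n) (z'.1.1 n)]
      · change dist z.π₀ z'.π₀ < s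
        rw [hzu, hzu']
        exact (hu'.1 0).trans_le (min_le_left _ _)
    · rintro u ⟨⟨c, hc, hcu⟩, -⟩
      exact h2 _ _ fun n => (hcu n).trans_lt (hc.trans_le (min_le_right _ _))
    · ext t
      constructor
      · rintro ⟨z, hz, rfl⟩
        obtain ⟨w, hw, hwz⟩ := h3 z fun n => (hz.1 n).trans_le (min_le_left _ _)
        exact ⟨w, ⟨⟨_, by linarith, fun n => (hw n).le⟩, z, hz, hwz.symm⟩, hwz⟩
      · rintro ⟨u, ⟨-, z, hz, hzu⟩, rfl⟩
        exact ⟨z, hz, hzu⟩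

lemma simZero_equivalence (P : Set W.Solenoid) {εY : ℝ} (hε : εY ∈ Set.Ioc 0 (W.β / 2)) :
    Equivalence (W.SimZero P εY) where
  refl x := (simZero_iff hε x x).2
    ⟨rfl, fun η hη => ⟨η, hη, fun z hz => ⟨z, hz, rfl⟩⟩,
      fun η hη => ⟨η, hη, fun z hz => ⟨z, hz, rfl⟩⟩⟩
  symm {x y} h := by
    obtain ⟨h0, h1, h2⟩ := (simZero_iff hε x y).1 h
    exact (simZero_iff hε y x).2 ⟨h0.symm, h2, h1⟩
  trans {x y z} h h' := by
    obtain ⟨h0, h1, h2⟩ := (simZero_iff hε x y).1 h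
    obtain ⟨k0, k1, k2⟩ := (simZero_iff hε y z).1 h'
    exact (simZero_iff hε x z).2 ⟨h0.trans k0, h1.trans k1, k2.trans h2⟩

end Helpers

lemma UnstableEquiv.map_φ {x y : W.Solenoid} (h : W.UnstableEquiv x y) :
    W.UnstableEquiv (W.φ x) (W.φ y) := by
  refine (tendsto_add_atTop_iff_nat 1).1 ?_
  simpa only [UnstableEquiv, Function.iterate_succ_apply, Equiv.symm_apply_apply] using h

variable {W} in
/-- `φ` restricts to a self-map of `X^u(P)` when `P` is `φ`-invariant. -/
def φGlobalUnstable {P : Set W.Solenoid} (hP : W.φ '' P = P) (x : W.GlobalUnstable P) :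
    W.GlobalUnstable P :=
  ⟨W.φ x.1, by
    obtain ⟨p, hp, h⟩ := x.2
    exact ⟨W.φ p, hP ▸ Set.mem_image_of_mem W.φ hp, h.map_φ⟩⟩

lemma Matches.map_φ [CompactSpace Y] {P : Set W.Solenoid} (hP : W.φ '' P = P)
    {x y : W.GlobalUnstable P} (h : Matches x y) :
    Matches (φGlobalUnstable hP x) (φGlobalUnstable hP y) := by
  have hP' : ∀ z : W.GlobalUnstable P, ∃ z' : W.GlobalUnstable P, φGlobalUnstable hP z' = z := by
    rintro ⟨z, p, hp, hz⟩
    rw [← hP] at hp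
    obtain ⟨p', hp', rfl⟩ := hp
    refine ⟨⟨W.φ.symm z, p', hp', ?_⟩, Subtype.ext (W.φ.apply_symm_apply z)⟩
    have := (tendsto_add_atTop_iff_nat 1).2 hz
    simpa only [UnstableEquiv, Function.iterate_succ_apply, Equiv.symm_apply_apply] using this
  intro η hη
  obtain ⟨a, ha, h1⟩ := W.exists_unif 1 hη
  obtain ⟨δ, hδ, h2⟩ := h a ha
  refine ⟨δ, hδ, fun z hz => ?_⟩
  obtain ⟨z, rfl⟩ := hP' z
  obtain ⟨w, hw, hwz⟩ := h2 z fun n => by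
    have := hz (n + 1)
    change dist (W.g (x.1.1 (n + 1))) (W.g (z.1.1 (n + 1))) < δ at this
    rwa [x.1.2 n, z.1.2 n] at this
  exact ⟨φGlobalUnstable hP w, fun n => h1 1 le_rfl _ _ (hw n), congrArg W.g hwz⟩

variable [CompactSpace Y]

/-- `∼₀` as a setoid on `X^u(P)`. -/
def simZeroSetoid (P : Set W.Solenoid) {εY : ℝ} (hε : εY ∈ Set.Ioc 0 (W.β / 2)) :
    Setoid (W.GlobalUnstable P) :=
  ⟨W.SimZero P εY, simZero_equivalence P hε⟩

/-- The quotient `X^u(P)/∼₀`. -/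
def UnstableQuotient (P : Set W.Solenoid) {εY : ℝ} (hε : εY ∈ Set.Ioc 0 (W.β / 2)) : Type _ :=
  Quotient (W.simZeroSetoid P hε)

/-- `X^u(P)/∼₀` carries the quotient topology of the unstable topology. -/
instance (P : Set W.Solenoid) {εY : ℝ} (hε : εY ∈ Set.Ioc 0 (W.β / 2)) :
    TopologicalSpace (W.UnstableQuotient P hε) :=
  inferInstanceAs (TopologicalSpace (Quotient (W.simZeroSetoid P hε)))

variable {W} in
/-- The map `g̃ [x] = [φ x] = [(g x₀, g x₁, …)]` on `X^u(P)/∼₀`. -/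
def gTilde {P : Set W.Solenoid} (hP : W.φ '' P = P) {εY : ℝ}
    (hε : εY ∈ Set.Ioc 0 (W.β / 2)) : W.UnstableQuotient P hε → W.UnstableQuotient P hε :=
  Quotient.map (φGlobalUnstable hP) fun x y h => by
    obtain ⟨h0, h1, h2⟩ := (simZero_iff hε x y).1 h
    exact (simZero_iff hε _ _).2 ⟨congrArg W.g h0, h1.map_φ W hP, h2.map_φ W hP⟩

end WielerPresolenoid

/-!
The proof is a shadowing argument based on a bracket map on the solenoid.

Iterating the second axiom (`exists_lift`) shows that if `t` is close to `z_K`, then some point `w`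
of the solenoid stays uniformly close to `z` in all coordinates and satisfies `w₀ = g^K t`. Taking
`t = y_K` gives a point with the zeroth coordinate of `y` on the local unstable set of `z`: the
bracket of the Smale space. Two consequences carry the proof.

* If `y₀ = z₀` and `y_K` is close to `z_K`, then sliding along stable sets identifies the local
  unstable sets of `y` and `z` without changing the zeroth coordinate, so `y ∼₀ z`
  (`exists_simZero_of_val_zero_eq`).
* The unstable ball around a point `x`, thickened in the stable direction, contains an open set `V`
  of the solenoid. By mixing and compactness, `φ^N V` comes close to every point for one common `N`.
  Points of `V` may be replaced by points of the unstable ball with the same zeroth coordinate, which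
  leaves the first `N + 1` coordinates of the `N`-th image unchanged; another application of
  `exists_lift` moves this image, within its unstable set, to a point with the zeroth coordinate of
  a given `y`. Since `φ^{-N}` merely drops coordinates, this last move stays small after pulling
  back, so the preimage still lies in the unstable ball (`exists_iterate_near`).

Hence every class `[y]` lies in the image under `g̃^N` of any open set containing `[x]`.
-/

namespace WielerPresolenoid

variable {Y : Type*} [MetricSpace Y] {W : WielerPresolenoid Y}

lemma φ_symm_iterate_val (x : W.Solenoid) (n k : ℕ) : (W.φ.symm^[n] x).1 k = x.1 (k + n) := by
  induction n generalizing x with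
  | zero => rfl
  | succ n ih =>
    rw [Function.iterate_succ_apply, ih, ← add_assoc]
    rfl

lemma distX_nonneg (x y : W.Solenoid) : 0 ≤ W.distX x y :=
  Finset.sum_nonneg fun i _ => mul_nonneg (pow_nonneg W.γ_pos.le i)
    (Real.iSup_nonneg fun n => mul_nonneg (pow_nonneg W.γ_pos.le n) dist_nonneg)

/-- A backward orbit of `g^K` is the restriction of a backward orbit of `g` to multiples of `K`. -/
lemma exists_solenoid_of_iterate_K {a : ℕ → Y} (ha : ∀ m, W.g^[W.K] (a (m + 1)) = a m) :
    ∃ w : W.Solenoid, ∀ m, w.1 (m * W.K) = a m := by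
  have hmul : ∀ j m, W.g^[j * W.K] (a (m + j)) = a m := by
    intro j
    induction j with
    | zero => intro m; simp
    | succ j ih =>
      intro m
      rw [Nat.succ_mul, Function.iterate_add_apply, ← add_assoc, ha, ih]
  have hle : ∀ n, n ≤ n * W.K := fun n => Nat.le_mul_of_pos_right n W.K_pos
  refine ⟨⟨fun n => W.g^[n * W.K - n] (a n), fun n => ?_⟩, fun m => ?_⟩
  · have h : (n + 1) * W.K - (n + 1) + 1 = (n * W.K - n) + W.K := by
      have h1 := hle n
      have h2 := hle (n + 1)
      rw [Nat.succ_mul] at h2 ⊢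
      omega
    change W.g (W.g^[(n + 1) * W.K - (n + 1)] (a (n + 1))) = W.g^[n * W.K - n] (a n)
    rw [← Function.iterate_succ_apply' W.g, Nat.succ_eq_add_one, h, Function.iterate_add_apply, ha]
  · have h := hmul (m * W.K - m) m
    rwa [Nat.sub_mul, Nat.add_sub_cancel' (hle m)] at h

/-- Points that stay within `β` of each other in all coordinates are unstably equivalent, because
the first axiom contracts the distance by `γ ^ K` every `K` coordinates. -/
lemma unstableEquiv_of_dist_le [CompactSpace Y] {x y : W.Solenoid}
    (h : ∀ n, dist (x.1 n) (y.1 n) ≤ W.β) : W.UnstableEquiv x y := by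
  have hγ := W.γ_pos
  have hβ := W.β_pos
  have hbound : ∀ n, dist (x.1 n) (y.1 n) ≤ W.β / W.γ ^ W.K * W.γ ^ n := by
    intro n
    induction n using Nat.strong_induction_on with
    | _ n ih =>
      rcases lt_or_ge n W.K with hn | hn
      · refine (h n).trans ?_
        rw [div_mul_eq_mul_div, le_div_iff₀ (pow_pos hγ _)]
        exact mul_le_mul_of_nonneg_left (pow_le_pow_of_le_one hγ.le W.γ_lt_one.le hn.le) hβ.le
      · obtain ⟨m, rfl⟩ := Nat.exists_eq_add_of_le' hn
        calc dist (x.1 (m + W.K)) (y.1 (m + W.K))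
            ≤ W.γ ^ W.K * dist (x.1 m) (y.1 m) := dist_val_add_K h m
          _ ≤ W.γ ^ W.K * (W.β / W.γ ^ W.K * W.γ ^ m) :=
              mul_le_mul_of_nonneg_left (ih m (Nat.lt_add_of_pos_right W.K_pos))
                (pow_nonneg hγ.le _)
          _ = W.β / W.γ ^ W.K * W.γ ^ (m + W.K) := by ring
  have hlim : Tendsto (fun n => W.β / W.γ ^ W.K * W.γ ^ n) atTop (𝓝 0) := by
    simpa using (tendsto_pow_atTop_nhds_zero_of_lt_one hγ.le W.γ_lt_one).const_mul
      (W.β / W.γ ^ W.K)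
  rw [UnstableEquiv, Metric.tendsto_atTop]
  intro η hη
  obtain ⟨δ, hδ, hδ'⟩ := W.exists_mem_localUnstable hη
  obtain ⟨N, hN⟩ := eventually_atTop.1 (hlim.eventually_lt_const hδ)
  refine ⟨N, fun n hn => ?_⟩
  rw [Real.dist_0_eq_abs, abs_of_nonneg (distX_nonneg _ _)]
  refine (hδ' _ _ fun k => ?_).2
  rw [φ_symm_iterate_val, φ_symm_iterate_val]
  exact (hbound _).trans_lt (hN _ (hn.trans (Nat.le_add_left n k)))

/-- Unstable equivalence to a point of `P` passes to points that are `β`-close in all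
coordinates. -/
lemma exists_unstableEquiv_of_dist_le [CompactSpace Y] {P : Set W.Solenoid}
    (x : W.GlobalUnstable P) {y : W.Solenoid} (h : ∀ n, dist (x.1.1 n) (y.1 n) ≤ W.β) :
    ∃ p ∈ P, W.UnstableEquiv y p := by
  obtain ⟨p, hp, hxp⟩ := x.2
  refine ⟨p, hp, ?_⟩
  have hyx : W.UnstableEquiv y x.1 := unstableEquiv_of_dist_le fun n => by
    rw [dist_comm]; exact h n
  exact squeeze_zero (fun n => distX_nonneg _ _)
    (fun n => distX_triangle _ (W.φ.symm^[n] x.1) _) (by simpa using hyx.add hxp)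

variable (W) in
/-- The lifting property behind the bracket: a point `t` near `z_K` determines a point of the
local unstable set of `z` whose zeroth coordinate is `g^K t`. -/
lemma exists_lift [CompactSpace Y] {η : ℝ} (hη : 0 < η) : ∃ ε > 0, ∀ (z : W.Solenoid) (t : Y),
    dist t (z.1 W.K) < ε → ∃ w : W.Solenoid, w.1 0 = W.g^[W.K] t ∧
      ∀ n, dist (z.1 n) (w.1 n) < η := by
  obtain ⟨δ, hδ, hunif⟩ := W.exists_unif (2 * W.K) hη
  have hε : 0 < min δ W.β := lt_min hδ W.β_pos
  refine ⟨min δ W.β, hε, fun z t ht => ?_⟩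
  have hstep : ∀ (m : ℕ) (s : Y), dist s (z.1 ((m + 1) * W.K)) < min δ W.β →
      ∃ s', dist s' (z.1 ((m + 2) * W.K)) < min δ W.β ∧ W.g^[2 * W.K] s' = W.g^[W.K] s := by
    intro m s hs
    have hz : W.g^[W.K] (z.1 ((m + 2) * W.K)) = z.1 ((m + 1) * W.K) := by
      rw [show (m + 2) * W.K = (m + 1) * W.K + W.K by ring, iterate_val]
    obtain ⟨s', hs', hss'⟩ := W.axiom2 (z.1 ((m + 2) * W.K)) _ hε (min_le_right _ _)
      (Set.mem_image_of_mem _ (by rw [hz]; exact hs))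
    exact ⟨s', (Metric.mem_ball.1 hs').trans_le
      (mul_le_of_le_one_left hε.le W.γ_lt_one.le), hss'⟩
  choose! f hf hfg using hstep
  let s : ℕ → Y := fun n => Nat.rec t f n
  have hs : ∀ m, dist (s m) (z.1 ((m + 1) * W.K)) < min δ W.β := by
    intro m
    induction m with
    | zero => simpa [s] using ht
    | succ m ih => exact hf m _ ih
  -- The second axiom controls `s m` only after `g^K` is applied, so the backward orbit is made
  -- of the points `g^K (s m)`.
  obtain ⟨w, hw⟩ := exists_solenoid_of_iterate_K (W := W) (a := fun m => W.g^[W.K] (s m))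
    fun m => by
      rw [← Function.iterate_add_apply, ← two_mul]
      exact hfg m _ (hs m)
  refine ⟨w, by simpa [s] using hw 0, fun n => ?_⟩
  obtain ⟨m, j, hj, hm⟩ := exists_mul_K (W := W) n
  have hwn : w.1 n = W.g^[j + W.K] (s m) := by
    rw [← iterate_val w n j, ← hm, hw, Function.iterate_add_apply]
  have hzn : z.1 n = W.g^[j + W.K] (z.1 ((m + 1) * W.K)) := by
    rw [show (m + 1) * W.K = n + (j + W.K) by rw [Nat.succ_mul, hm, add_assoc], iterate_val]
  rw [hwn, hzn, dist_comm]
  exact hunif _ (by omega) _ _ ((hs m).trans_le (min_le_left _ _))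

variable (W) in
/-- Points with the same zeroth coordinate and nearby coordinates with index `K` have local
unstable sets that match under the stable holonomy. -/
lemma exists_matches_of_val_zero_eq [CompactSpace Y] (P : Set W.Solenoid) :
    ∃ ε > 0, ∀ y z : W.GlobalUnstable P, y.π₀ = z.π₀ →
      dist (y.1.1 W.K) (z.1.1 W.K) < ε → Matches y z := by
  obtain ⟨ε, hε, hlift⟩ := W.exists_lift W.β_pos
  refine ⟨ε / 2, half_pos hε, fun y z h0 hK η hη => ?_⟩
  obtain ⟨δ, hδ, hδ'⟩ := W.exists_of_val_zero hη
  refine ⟨min δ (ε / 2), lt_min hδ (half_pos hε), fun u hu => ?_⟩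
  obtain ⟨w, hw0, hw⟩ := hlift z.1 (u.1.1 W.K) (by
    have h1 := (hu W.K).trans_le (min_le_right _ _)
    rw [dist_comm] at h1
    linarith [dist_triangle (u.1.1 W.K) (y.1.1 W.K) (z.1.1 W.K)])
  have hwu : w.1 0 = u.1.1 0 := by
    have h1 := iterate_val u.1 0 W.K
    rw [zero_add] at h1
    rw [hw0, h1]
  refine ⟨⟨w, exists_unstableEquiv_of_dist_le z fun n => (hw n).le⟩,
    -- Lifting only gives `β`-closeness here, but a `β`-close pair is as close as its zeroth
    -- coordinates force it to be.
    hδ' z.1 w (fun n => (hw n).le) ?_, hwu⟩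
  rw [hwu]
  change dist z.π₀ _ < δ
  rw [← h0]
  exact (hu 0).trans_le (min_le_left _ _)

variable (W) in
lemma exists_simZero_of_val_zero_eq [CompactSpace Y] (P : Set W.Solenoid) {εY : ℝ}
    (hε : εY ∈ Set.Ioc 0 (W.β / 2)) :
    ∃ ε > 0, ∀ y z : W.GlobalUnstable P, y.π₀ = z.π₀ →
      dist (y.1.1 W.K) (z.1.1 W.K) < ε → W.SimZero P εY y z := by
  obtain ⟨ε, hε0, h⟩ := W.exists_matches_of_val_zero_eq P
  refine ⟨ε, hε0, fun y z h0 hK => (simZero_iff hε y z).2 ⟨h0, h y z h0 hK, ?_⟩⟩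
  exact h z y h0.symm (by rwa [dist_comm])

/-- A mixing system sends a non-empty open set, at one common time, close to all points in a
given coordinate. -/
lemma exists_iterate_val_dist_lt [CompactSpace Y] (hmix : IsMixing W.φ) {V : Set W.Solenoid}
    (hV : IsOpen V) (hne : V.Nonempty) (k M : ℕ) {r : ℝ} (hr : 0 < r) :
    ∃ N ≥ M, ∀ y : W.Solenoid, ∃ v ∈ V, dist ((W.φ^[N] v).1 k) (y.1 k) < r := by
  obtain ⟨F, hFfin, hF⟩ := Metric.totallyBounded_iff.1
    (isCompact_univ (X := Y)).totallyBounded (r / 2) (half_pos hr)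
  -- `A c` may be empty, as the points `c` of the net are not chosen as coordinates of points of
  -- the solenoid; mixing is used for the non-empty ones.
  let A : Y → Set W.Solenoid := fun c => {z | dist (z.1 k) c < r / 2}
  have hA : ∀ c, IsOpen (A c) := fun c => isOpen_lt
    (((continuous_apply k).comp continuous_subtype_val).dist continuous_const) continuous_const
  have hev : ∀ c ∈ F, ∀ᶠ n in atTop, (A c).Nonempty → (W.φ^[n] '' V ∩ A c).Nonempty := by
    intro c _
    by_cases hc : (A c).Nonempty
    · obtain ⟨N, hN⟩ := hmix V (A c) hV (hA c) hne hc
      exact eventually_atTop.2 ⟨N, fun n hn _ => hN n hn⟩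
    · exact Eventually.of_forall fun n h => absurd h hc
  obtain ⟨N, hN, hM⟩ := (((eventually_all_finite hFfin).2 hev).and (eventually_ge_atTop M)).exists
  refine ⟨N, hM, fun y => ?_⟩
  obtain ⟨c, hc, hyc⟩ := Set.mem_iUnion₂.1 (hF (Set.mem_univ (y.1 k)))
  obtain ⟨_, ⟨v, hv, rfl⟩, hvc⟩ := hN c hc ⟨y, hyc⟩
  refine ⟨v, hv, ?_⟩
  have h1 : dist ((W.φ^[N] v).1 k) c < r / 2 := hvc
  have h2 : dist (y.1 k) c < r / 2 := hyc
  linarith [dist_triangle_right ((W.φ^[N] v).1 k) (y.1 k) c]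

/-- For a mixing solenoid, some iterate of any local unstable set meets the local stable set of
every point `y`: it contains a point with the zeroth coordinate of `y` that is also close to `y`
in the coordinate with index `K`. -/
lemma exists_iterate_near [CompactSpace Y] (hmix : IsMixing W.φ) (x : W.Solenoid) {δ ε : ℝ}
    (hδ : 0 < δ) (hε : 0 < ε) :
    ∃ N : ℕ, ∀ y : W.Solenoid, ∃ q : W.Solenoid, (∀ n, dist (x.1 n) (q.1 n) < δ) ∧
      (W.φ^[N] q).1 0 = y.1 0 ∧ dist ((W.φ^[N] q).1 W.K) (y.1 W.K) < ε := by
  obtain ⟨a, ha, hlift⟩ := W.exists_lift (half_pos hδ)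
  obtain ⟨b, hb, hlift'⟩ := W.exists_lift (lt_min (half_pos hδ) (half_pos hε))
  have hV : IsOpen {v : W.Solenoid | dist (v.1 W.K) (x.1 W.K) < a} := isOpen_lt
    (((continuous_apply W.K).comp continuous_subtype_val).dist continuous_const) continuous_const
  obtain ⟨N, hNK, hN⟩ := exists_iterate_val_dist_lt hmix hV ⟨x, by simpa using ha⟩ W.K W.K
    (lt_min hb (half_pos hε))
  refine ⟨N, fun y => ?_⟩
  obtain ⟨v, hv, hvy⟩ := hN y
  obtain ⟨u, hu0, hu⟩ := hlift x (v.1 W.K) hv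
  have huv : u.1 0 = v.1 0 := by
    have h1 := iterate_val v 0 W.K
    rw [zero_add] at h1
    rw [hu0, h1]
  -- Coordinates of `φ^N u` with index at most `N` are determined by `u₀`.
  have hK : ∀ u : W.Solenoid, (W.φ^[N] u).1 W.K = W.g^[N - W.K] (u.1 0) := by
    intro u
    have h1 := iterate_val u 0 W.K
    rw [zero_add] at h1
    rw [φ_iterate_val, ← h1, ← Function.iterate_add_apply, Nat.sub_add_cancel hNK]
  have huy : dist ((W.φ^[N] u).1 W.K) (y.1 W.K) < min b (ε / 2) := by
    rwa [hK, huv, ← hK]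
  obtain ⟨z, hz0, hz⟩ := hlift' (W.φ^[N] u) (y.1 W.K) (by
    rw [dist_comm]; exact huy.trans_le (min_le_left _ _))
  have hφ : W.φ^[N] (W.φ.symm^[N] z) = z :=
    (Function.RightInverse.iterate W.φ.right_inv N) z
  refine ⟨W.φ.symm^[N] z, fun n => ?_, ?_, ?_⟩
  · have h1 := (hz (n + N)).trans_le (min_le_left _ _)
    rw [φ_iterate_val, iterate_val] at h1
    rw [φ_symm_iterate_val]
    linarith [hu n, dist_triangle (x.1 n) (u.1 n) (z.1 (n + N))]
  · have h1 := iterate_val y 0 W.K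
    rw [zero_add] at h1
    rw [hφ, hz0, h1]
  · rw [hφ]
    have h1 := (hz W.K).trans_le (min_le_right _ _)
    have h2 := huy.trans_le (min_le_right _ _)
    linarith [dist_triangle_left (z.1 W.K) (y.1 W.K) ((W.φ^[N] u).1 W.K)]

lemma φGlobalUnstable_iterate_val {P : Set W.Solenoid} (hP : W.φ '' P = P)
    (x : W.GlobalUnstable P) (N : ℕ) : ((φGlobalUnstable hP)^[N] x).1 = W.φ^[N] x.1 := by
  induction N generalizing x with
  | zero => rfl
  | succ N ih => rw [Function.iterate_succ_apply, ih, Function.iterate_succ_apply]; rfl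

lemma gTilde_iterate_mk [CompactSpace Y] {P : Set W.Solenoid} (hP : W.φ '' P = P) {εY : ℝ}
    (hε : εY ∈ Set.Ioc 0 (W.β / 2)) (x : W.GlobalUnstable P) (N : ℕ) :
    (gTilde hP hε)^[N] (Quotient.mk (W.simZeroSetoid P hε) x) =
      Quotient.mk (W.simZeroSetoid P hε) ((φGlobalUnstable hP)^[N] x) := by
  induction N generalizing x with
  | zero => rfl
  | succ N ih => exact ih (φGlobalUnstable hP x)

end WielerPresolenoid

theorem mainTheorem9 {Y : Type*} [MetricSpace Y] [CompactSpace Y]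
    (W : WielerPresolenoid Y) (hmix : IsMixing W.φ)
    (P : Set W.Solenoid) (hPfin : P.Finite) (hPinv : W.φ '' P = P)
    (hPper : ∀ p ∈ P, p ∈ Function.periodicPts W.φ)
    (εY : ℝ) (hε : εY ∈ Set.Ioc 0 (W.β / 2))
    (U : Set (W.UnstableQuotient P hε)) (hU : IsOpen U) (hne : U.Nonempty) :
    ∃ N : ℕ, (WielerPresolenoid.gTilde hPinv hε)^[N] '' U = Set.univ := by
  obtain ⟨⟨x⟩, hx⟩ := hne
  obtain ⟨δ, hδ, hball⟩ := WielerPresolenoid.GlobalUnstable.isOpen_iff.1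
    (hU.preimage (continuous_quotient_mk' (s := W.simZeroSetoid P hε))) x hx
  obtain ⟨r, hr, hr'⟩ := W.exists_mem_localUnstable hδ
  obtain ⟨ε, hε0, hsim⟩ := W.exists_simZero_of_val_zero_eq P hε
  obtain ⟨N, hN⟩ := WielerPresolenoid.exists_iterate_near hmix x.1 (lt_min hr W.β_pos) hε0
  refine ⟨N, Set.eq_univ_of_forall ?_⟩
  rintro ⟨y⟩
  obtain ⟨q, hxq, hq0, hqK⟩ := hN y.1
  let q' : W.GlobalUnstable P := ⟨q, WielerPresolenoid.exists_unstableEquiv_of_dist_le x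
    fun n => (hxq n).le.trans (min_le_right _ _)⟩
  have hq' : q' ∈ x.ball δ := hr' x.1 q fun n => (hxq n).trans_le (min_le_left _ _)
  have hval := WielerPresolenoid.φGlobalUnstable_iterate_val hPinv q' N
  refine ⟨Quotient.mk (W.simZeroSetoid P hε) q', hball hq', ?_⟩
  rw [WielerPresolenoid.gTilde_iterate_mk]
  refine Quotient.sound (s := W.simZeroSetoid P hε) (hsim _ y ?_ ?_)
  · rw [WielerPresolenoid.GlobalUnstable.π₀, hval]
    exact hq0
  · rw [hval]
    exact hqK
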